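/- Let $X$ be a topological space such that - $X$ is \emph{retral}: $X$ can be embedded as a retract in a topological group, i.e. there are a topological group $G$, a topological embedding $e\colon X\to G$ and a continuous map $r\colon G\to X$ with $r\circ e=\mathrm{id}_X$; and - $X$ is $\Sigma^-(\aleph_0)$: there are a cover $\mathcal K$ of $X$ by pseudocompact sets (subspaces on which every continuous real-valued function is bounded) and a countable family $\mathcal N$ of subsets of $X$ which is a network for $\mathcal K$, i.e. whenever $K\in\mathcal K$ is contained in an open set $U\subseteq X$, there is $N\in\mathcal N$ with $K\subseteq N\subseteq U$. Then $X$ has calibre $(\omega_1,\omega_1,2)$ (the Knaster property): for every family $(U_i)_{i\in I}$ of non-empty open subsets of $X$ with $|I|=\aleph_1$ there is $A\subseteq I$ with $|A|=\aleph_1$ such that $U_i\cap U_j\neq\emptyset$ for all distinct $i,j\in A$. -/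

import Mathlib

universe u v

/-- The subspace `S` of the space `Y` has relative calibre `(κ, l, μ)` in `Y`: every (indexed)
family of `κ` many open sets of `Y`, each meeting `S`, has a subfamily of size `l` all of whose
subcollections of size `μ` have non-empty intersection. -/
def HasRelativeCalibre {Y : Type u} [TopologicalSpace Y] (S : Set Y)
    (κ l μ : Cardinal.{u}) : Prop :=
  ∀ (ι : Type u) (U : ι → Set Y), Cardinal.mk ι = κ →
    (∀ i, IsOpen (U i)) → (∀ i, (U i ∩ S).Nonempty) →
    ∃ A : Set ι, Cardinal.mk A = l ∧
      ∀ B : Set ι, B ⊆ A → Cardinal.mk B = μ → (⋂ i ∈ B, U i).Nonempty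

/-- The space `X` has calibre `(κ, l, μ)`: it has this relative calibre in itself. -/
def HasCalibre (X : Type u) [TopologicalSpace X] (κ l μ : Cardinal.{u}) : Prop :=
  HasRelativeCalibre (Set.univ : Set X) κ l μ

/-- `X` is retral: it can be embedded as a retract in a topological group. -/
def IsRetral (X : Type u) [TopologicalSpace X] : Prop :=
  ∃ (G : Type v) (_ : Group G) (_ : TopologicalSpace G) (_ : IsTopologicalGroup G)
    (e : X → G) (r : G → X),
    Topology.IsEmbedding e ∧ Continuous r ∧ ∀ x, r (e x) = x

/-- `K` is a pseudocompact set: every continuous real-valued function on the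
subspace `K` is bounded. -/
def IsPseudocompactSet {X : Type*} [TopologicalSpace X] (K : Set X) : Prop :=
  ∀ f : K → ℝ, Continuous f → ∃ M : ℝ, ∀ x, |f x| ≤ M

/-- `N` is a network for the collection `C`: whenever a member of `C` is contained in an open
set, some member of `N` lies between them. -/
def IsNetworkFor {X : Type*} [TopologicalSpace X] (N C : Set (Set X)) : Prop :=
  ∀ K ∈ C, ∀ U : Set X, IsOpen U → K ⊆ U → ∃ S ∈ N, K ⊆ S ∧ S ⊆ U

/-- `X` is `Σ⁻(ℵ₀)`: it has a cover by pseudocompact sets and a countable network for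
this cover. -/
def IsSigmaMinus (X : Type*) [TopologicalSpace X] : Prop :=
  ∃ C : Set (Set X), (∀ K ∈ C, IsPseudocompactSet K) ∧ ⋃₀ C = Set.univ ∧
    ∃ N : Set (Set X), N.Countable ∧ IsNetworkFor N C

open Set Filter Topology

/-! The Mal'tsev point `r (e x * (e y)⁻¹ * e z)` drives the proof. Pseudocompact sets are totally
bounded in both group uniformities, so finite colourings detect closeness to a point of order `V i`.
Countability of the network makes the coloured set and the number of colours constant on uncountably
many indices. Without an uncountable linked subfamily there is an infinite disjoint one, and colour
coincidences there put a single Mal'tsev point into two disjoint `U i`. -/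

theorem IsPseudocompactSet.exists_finite_left_cover {X G : Type*} [TopologicalSpace X] [Group G]
    [TopologicalSpace G] [IsTopologicalGroup G] {K : Set X} (hK : IsPseudocompactSet K)
    {g : X → G} (hg : Continuous g) {V : Set G} (hV : V ∈ 𝓝 (1 : G)) :
    ∃ t : Finset X, ∀ z ∈ K, ∃ y ∈ t, (g y)⁻¹ * g z ∈ V := by
  by_contra! hcon
  have hseq : ∀ s : Finset X, (∀ x ∈ s, x ∈ K) →
      ∃ y, y ∈ K ∧ ∀ x ∈ s, (g x)⁻¹ * g y ∉ V := fun s _ => hcon s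
  obtain ⟨y, hyK, hy⟩ := exists_seq_of_forall_finset_exists _ _ hseq
  obtain ⟨W, hW, hWV⟩ := exists_nhds_one_split4 hV
  set W₀ : Set G := interior W ∩ (interior W)⁻¹ with hW₀
  have hopen : IsOpen W₀ := isOpen_interior.inter isOpen_interior.inv
  have hone : (1 : G) ∈ W₀ := by
    have h1 : (1 : G) ∈ interior W := mem_interior_iff_mem_nhds.2 hW
    exact ⟨h1, by simpa using h1⟩
  have hsub : ∀ {w}, w ∈ W₀ → w ∈ W := fun h => interior_subset h.1
  have hinv : ∀ {w}, w ∈ W₀ → w⁻¹ ∈ W := fun h => interior_subset h.2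
  -- Each translate `z W₀` meets at most one `g (y k) W₀`. Bumps of height `k` on these are thus
  -- locally finite, with a continuous sum unbounded on `K`.
  have key : ∀ {j k : ℕ} {z z₁ z₂ : G}, (g (y j))⁻¹ * z₁ ∈ W₀ → z⁻¹ * z₁ ∈ W₀ →
      (g (y k))⁻¹ * z₂ ∈ W₀ → z⁻¹ * z₂ ∈ W₀ → j = k := by
    have aux : ∀ {j k : ℕ} {z z₁ z₂ : G}, (g (y j))⁻¹ * z₁ ∈ W₀ → z⁻¹ * z₁ ∈ W₀ →
        (g (y k))⁻¹ * z₂ ∈ W₀ → z⁻¹ * z₂ ∈ W₀ → ¬ j < k := by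
      intro j k z z₁ z₂ h1 h2 h3 h4 hjk
      refine hy j k hjk ?_
      have := hWV (hsub h1) (hinv h2) (hsub h4) (hinv h3)
      convert this using 1
      group
    intro j k z z₁ z₂ h1 h2 h3 h4
    exact le_antisymm (not_lt.1 (aux h3 h4 h1 h2)) (not_lt.1 (aux h1 h2 h3 h4))
  let _ := IsTopologicalGroup.rightUniformSpace G
  obtain ⟨φ, hφ, hφ1, hφ0⟩ :=
    CompletelyRegularSpace.completely_regular (1 : G) W₀ᶜ hopen.isClosed_compl (by simpa using hone)
  let F : ℕ → X → ℝ := fun k z => k * (1 - (φ ((g (y k))⁻¹ * g z) : ℝ))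
  have hF0 : ∀ k z, (g (y k))⁻¹ * g z ∉ W₀ → F k z = 0 := by
    intro k z hz
    have : φ ((g (y k))⁻¹ * g z) = 1 := hφ0 hz
    simp [F, this]
  have hFs : ∀ {k z}, F k z ≠ 0 → (g (y k))⁻¹ * g z ∈ W₀ := fun h =>
    not_not.1 fun h' => h (hF0 _ _ h')
  have hcont : Continuous fun z => ∑ᶠ k, F k z := by
    refine continuous_finsum (fun k => by fun_prop) fun z => ?_
    refine ⟨{z' | (g z)⁻¹ * g z' ∈ W₀}, ?_, ?_⟩
    · exact (hopen.preimage (continuous_const.mul hg)).mem_nhds (by simpa using hone)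
    · refine Set.Subsingleton.finite ?_
      rintro j ⟨z₁, h1, h2⟩ k ⟨z₂, h3, h4⟩
      exact key (hFs h1) h2 (hFs h3) h4
  obtain ⟨M, hM⟩ := hK (fun z => ∑ᶠ k, F k z) (hcont.comp continuous_subtype_val)
  obtain ⟨n, hn⟩ := exists_nat_gt M
  have hval : ∑ᶠ k, F k (y n) = n := by
    rw [finsum_eq_single _ n]
    · simp [F, hφ1]
    · intro k hk
      refine hF0 _ _ fun h => hk ?_
      exact key (z := g (y n)) (z₂ := g (y n)) h (by simpa using hone) (by simpa using hone) (by simpa using hone)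
  have := hM ⟨y n, hyK n⟩
  simp only [hval] at this
  rw [abs_of_nonneg (Nat.cast_nonneg n)] at this
  linarith

/-- Around a pseudocompact set there is an open set that splits into finitely many pieces,
each of them small of order `V` for the left and for the right uniformity. -/
theorem IsPseudocompactSet.exists_coloring {X G : Type*} [TopologicalSpace X] [Group G]
    [TopologicalSpace G] [IsTopologicalGroup G] {K : Set X} (hK : IsPseudocompactSet K)
    {e : X → G} (he : Continuous e) {V : Set G} (hV : V ∈ 𝓝 (1 : G)) :
    ∃ U : Set X, IsOpen U ∧ K ⊆ U ∧ ∃ (n : ℕ) (c : X → Fin (n + 1)), ∀ z ∈ U, ∀ z' ∈ U,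
      c z = c z' → (e z)⁻¹ * e z' ∈ V ∧ e z * (e z')⁻¹ ∈ V := by
  classical
  obtain ⟨W, hWo, hW1, hW⟩ := exists_open_nhds_one_split hV
  have hWW : IsOpen (W ∩ W⁻¹) := hWo.inter hWo.inv
  have hWn : W ∩ W⁻¹ ∈ 𝓝 (1 : G) := hWW.mem_nhds ⟨hW1, by simpa using hW1⟩
  obtain ⟨s, hs⟩ := hK.exists_finite_left_cover he hWn
  -- Inversion turns left covers into right ones.
  obtain ⟨t, ht⟩ := hK.exists_finite_left_cover he.inv hWn
  let B : X × X → Set X := fun p =>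
    {z | (e p.1)⁻¹ * e z ∈ W ∩ W⁻¹} ∩ {z | ((e p.2)⁻¹)⁻¹ * (e z)⁻¹ ∈ W ∩ W⁻¹}
  have hB : ∀ p, IsOpen (B p) := fun p =>
    (hWW.preimage (continuous_const.mul he)).inter
      (hWW.preimage (continuous_const.mul he.inv))
  refine ⟨⋃ p ∈ s ×ˢ t, B p, isOpen_biUnion fun p _ => hB p, ?_, ?_⟩
  · intro z hz
    obtain ⟨a, ha, haz⟩ := hs z hz
    obtain ⟨b, hb, hbz⟩ := ht z hz
    exact mem_biUnion (x := (a, b)) (by simp [ha, hb]) ⟨haz, hbz⟩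
  · let q : X → Option (s ×ˢ t : Finset (X × X)) := fun z =>
      if h : ∃ p : (s ×ˢ t : Finset (X × X)), z ∈ B p then some h.choose else none
    have hq : ∀ z ∈ ⋃ p ∈ s ×ˢ t, B p, ∃ p, q z = some p ∧ z ∈ B p := by
      intro z hz
      obtain ⟨p, hp, hzp⟩ := mem_iUnion₂.1 hz
      have h : ∃ p : (s ×ˢ t : Finset (X × X)), z ∈ B p := ⟨⟨p, hp⟩, hzp⟩
      exact ⟨h.choose, by simp only [q, dif_pos h], h.choose_spec⟩
    let f := Fintype.equivFin (Option (s ×ˢ t : Finset (X × X)))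
    refine ⟨Fintype.card (Option (s ×ˢ t : Finset (X × X))), fun z => (f (q z)).castSucc, ?_⟩
    intro z hz z' hz' hc
    have hqq : q z = q z' := f.injective (Fin.castSucc_injective _ hc)
    obtain ⟨p, hp, hzp⟩ := hq z hz
    obtain ⟨p', hp', hzp'⟩ := hq z' hz'
    obtain rfl : p = p' := Option.some.inj (by rw [← hp, ← hp', hqq])
    constructor
    · have := hW _ hzp.1.2 _ hzp'.1.1
      convert this using 1
      group
    · have := hW _ hzp.2.2 _ hzp'.2.1
      convert this using 1
      group

/-- A graph on an uncountable set has an uncountable independent set or an infinite clique. -/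
theorem exists_uncountable_pairwise_not_or_seq {ι : Type*} (r : ι → ι → Prop)
    (hr : ∀ i j, r i j → r j i) {A : Set ι} (hA : ¬ A.Countable) :
    (∃ B ⊆ A, ¬ B.Countable ∧ B.Pairwise fun i j => ¬ r i j) ∨
      ∃ a : ℕ → ι, (∀ n, a n ∈ A) ∧ ∀ m n, m < n → r (a m) (a n) := by
  by_cases hind : ∃ B ⊆ A, ¬ B.Countable ∧ B.Pairwise fun i j => ¬ r i j
  · exact Or.inl hind
  refine Or.inr ?_
  push Not at hind
  -- Otherwise a maximal independent subset of `B`, which is countable, together with its countably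
  -- many neighbours would exhaust `B`.
  have step : ∀ B : {B : Set ι // B ⊆ A ∧ ¬ B.Countable},
      ∃ i ∈ B.1, ¬ (B.1 ∩ {j | r i j}).Countable := by
    rintro ⟨B, hBA, hB⟩
    by_contra! hdeg
    obtain ⟨S, hS⟩ := zorn_subset {S : Set ι | S ⊆ B ∧ S.Pairwise fun i j => ¬ r i j} (by
      intro c hc hchain
      refine ⟨⋃₀ c, ⟨sUnion_subset fun s hs => (hc hs).1, ?_⟩, fun s hs => subset_sUnion_of_mem hs⟩
      exact (pairwise_sUnion hchain.directedOn).2 fun s hs => (hc hs).2)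
    have hSc : S.Countable := by
      by_contra h
      exact hind S (hS.prop.1.trans hBA) h hS.prop.2
    refine hB ((hSc.union (hSc.biUnion fun i hi => hdeg i (hS.prop.1 hi))).mono ?_)
    intro j hj
    by_contra hjn
    simp only [mem_union, mem_iUnion, mem_inter_iff, mem_ofPred_eq, not_or, not_exists,
      not_and] at hjn
    have hins : insert j S ∈ {S : Set ι | S ⊆ B ∧ S.Pairwise fun i j => ¬ r i j} := by
      refine ⟨insert_subset hj hS.prop.1, hS.prop.2.insert fun i hi _ => ?_⟩
      exact ⟨fun h => hjn.2 i hi hj (hr _ _ h), hjn.2 i hi hj⟩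
    exact hjn.1 (hS.le_of_ge hins (subset_insert _ _) (mem_insert _ _))
  choose p hp hpc using step
  let next : {B : Set ι // B ⊆ A ∧ ¬ B.Countable} → {B : Set ι // B ⊆ A ∧ ¬ B.Countable} :=
    fun B => ⟨B.1 ∩ {j | r (p B) j}, inter_subset_left.trans B.2.1, hpc B⟩
  let seq : ℕ → {B : Set ι // B ⊆ A ∧ ¬ B.Countable} :=
    fun n => Nat.rec ⟨A, Subset.rfl, hA⟩ (fun _ B => next B) n
  have hanti : Antitone fun n => (seq n).1 := antitone_nat_of_succ_le fun n => inter_subset_left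
  refine ⟨fun n => p (seq n), fun n => (seq n).2.1 (hp _), fun m n hmn => ?_⟩
  exact (hanti (Nat.succ_le_of_lt hmn) (hp (seq n))).2

/-- Colours have limits along a nonprincipal ultrafilter in either argument; `a`, `g`, `b` are
chosen in turn to attain them. -/
theorem exists_triple_of_colorings {κ : Type*} [Finite κ] (c : ℕ → ℕ → κ) :
    ∃ a g b, a < g ∧ g < b ∧ c a g = c a b ∧ c b a = c b g := by
  let u := hyperfilter ℕ
  have hgt : ∀ n : ℕ, ∀ᶠ k in (u : Filter ℕ), n < k := fun n =>
    (Nat.hyperfilter_le_atTop) (eventually_gt_atTop n)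
  have lim : ∀ h : ℕ → κ, ∃ i, ∀ᶠ k in (u : Filter ℕ), h k = i := fun h =>
    Ultrafilter.eventually_exists_iff.1 (Eventually.of_forall fun k => ⟨h k, rfl⟩)
  choose i hi using fun a => lim (c a)
  choose j hj using fun a => lim fun b => c b a
  obtain ⟨j₀, hj₀⟩ := lim j
  obtain ⟨a, ha⟩ := hj₀.exists
  obtain ⟨g, hag, hg, hgj⟩ := ((hgt a).and ((hi a).and hj₀)).exists
  obtain ⟨b, hgb, hb, hba, hbg⟩ := ((hgt g).and ((hi a).and ((hj a).and (hj g)))).exists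
  exact ⟨a, g, b, hag, hgb, hg.trans hb.symm, by rw [hba, hbg, ha, hgj]⟩

theorem mainTheorem2 (X : Type u) [TopologicalSpace X]
    (hretral : IsRetral.{u, v} X) (hsigma : IsSigmaMinus X) :
    HasCalibre X (Cardinal.aleph 1) (Cardinal.aleph 1) 2 := by
  intro ι U hι hUo hUne
  obtain ⟨G, _, _, _, e, r, he, hrc, hre⟩ := hretral
  obtain ⟨C, hC, hcov, N, hN, hnet⟩ := hsigma
  choose x hx using hUne
  have hxU : ∀ i, x i ∈ U i := fun i => (hx i).1
  have hV : ∀ i, ∃ V ∈ 𝓝 (1 : G), ∀ v ∈ V, r (e (x i) * v) ∈ U i ∧ r (v * e (x i)) ∈ U i := by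
    intro i
    have h1 : Tendsto (fun v : G => r (e (x i) * v)) (𝓝 1) (𝓝 (x i)) := by
      have : Continuous fun v : G => r (e (x i) * v) := by fun_prop
      simpa [hre] using this.tendsto 1
    have h2 : Tendsto (fun v : G => r (v * e (x i))) (𝓝 1) (𝓝 (x i)) := by
      have : Continuous fun v : G => r (v * e (x i)) := by fun_prop
      simpa [hre] using this.tendsto 1
    have hU := (hUo i).mem_nhds (hxU i)
    exact ⟨_, (h1.eventually hU).and (h2.eventually hU), fun v hv => hv⟩
  choose V hV1 hVU using hV
  have hcol : ∀ i, ∃ S ∈ N, x i ∈ S ∧ ∃ (n : ℕ) (c : X → Fin (n + 1)), ∀ z ∈ S, ∀ z' ∈ S,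
      c z = c z' → (e z)⁻¹ * e z' ∈ V i ∧ e z * (e z')⁻¹ ∈ V i := by
    intro i
    obtain ⟨K, hK, hxK⟩ : x i ∈ ⋃₀ C := hcov ▸ mem_univ _
    obtain ⟨O, hO, hKO, n, c, hc⟩ := (hC K hK).exists_coloring he.continuous (hV1 i)
    obtain ⟨S, hS, hKS, hSO⟩ := hnet K hK O hO hKO
    exact ⟨S, hS, hKS hxK, n, c, fun z hz z' hz' => hc z (hSO hz) z' (hSO hz')⟩
  choose S hSN hxS n c hc using hcol
  have huniv : ¬ (univ : Set ι).Countable := by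
    rw [← Cardinal.le_aleph0_iff_set_countable, Cardinal.mk_univ, hι, not_le]
    exact Cardinal.aleph0_lt_aleph_one
  obtain ⟨T, m, hTm⟩ : ∃ T m, ¬ {i | S i = T ∧ n i = m}.Countable := by
    by_contra! h
    refine huniv ((hN.biUnion fun T _ => countable_iUnion fun m => h T m).mono fun i _ => ?_)
    exact mem_biUnion (hSN i) (mem_iUnion.2 ⟨n i, rfl, rfl⟩)
  rcases exists_uncountable_pairwise_not_or_seq (fun i j => Disjoint (U i) (U j))
    (fun i j h => h.symm) hTm with ⟨B, -, hB, hBp⟩ | ⟨a, ha, had⟩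
  · refine ⟨B, le_antisymm ?_ ?_, ?_⟩
    · exact hι ▸ Cardinal.mk_set_le B
    · rwa [← Cardinal.le_aleph0_iff_set_countable, not_le, ← Order.succ_le_iff,
        Cardinal.succ_aleph0] at hB
    · intro D hD hD2
      obtain ⟨i, j, hij, rfl⟩ : ∃ i j, i ≠ j ∧ D = {i, j} := by
        rw [← Set.ncard_eq_two, Set.ncard_def, Set.encard, ENat.card, hD2]
        simp
      have := not_disjoint_iff_nonempty_inter.1 (hBp (hD (by simp)) (hD (by simp)) hij)
      simpa using this
  · exfalso
    obtain ⟨p, g, q, hpg, hgq, h1, h2⟩ := exists_triple_of_colorings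
      fun k l => Fin.cast (congrArg (· + 1) (ha k).2) (c (a k) (x (a l)))
    have hmem : ∀ k l, x (a k) ∈ S (a l) := fun k l => by
      rw [(ha l).1, ← (ha k).1]; exact hxS _
    have h1' := (hc (a p) _ (hmem g p) _ (hmem q p) (Fin.cast_injective _ h1)).1
    have h2' := (hc (a q) _ (hmem p q) _ (hmem g q) (Fin.cast_injective _ h2)).2
    -- The common point is `r (e x_p * (e x_g)⁻¹ * e x_q)`, bracketed in two ways.
    have hp := (hVU _ _ h1').1
    have hq := (hVU _ _ h2').2
    rw [← mul_assoc] at hp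
    exact disjoint_left.1 (had p q (hpg.trans hgq)) hp hq
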